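/- Let $\gamma$ run through the set of ordinates of the non-trivial zeros of the Riemann zeta function (the zeros $\rho$ with $0<\mathrm{Re}\,\rho<1$), and let $N(T)$ be the number of non-trivial zeros with imaginary part in $[0,T]$, counted with multiplicity. Assume the Effective LI conjecture: for every $\varepsilon>0$ there is a constant $C_\varepsilon>0$ such that for all real $T\ge 2$ and all integers $(\ell_\gamma)_{0<\gamma\le T}$, not all zero, with $|\ell_\gamma|\le N(T)$ we have $$\Big|\sum_{0<\gamma\le T}\ell_\gamma\gamma\Big|\ \ge\ C_\varepsilon e^{-T^{1+\varepsilon}}.$$ Let $\{r_\gamma\}_{\gamma>0}$ be a sequence of complex numbers for which there is a constant $A>0$ with $\sum_{0<\gamma\le T}|r_\gamma|\asymp(\log T)^A$ as $T\to\infty$, and put $$F(t,T):=\mathrm{Re}\Big(\sum_{0<\gamma\le T}e^{i\gamma t}r_\gamma\Big)=\sum_{0<\gamma\le T}|r_\gamma|\cos(\gamma t+\arg r_\gamma).$$ Let $\varepsilon>0$ be fixed. Then there exist positive constants $c_1,c_2,C$ (depending at most on $\{r_\gamma\}$, $A$ and $\varepsilon$) such that for all sufficiently large $X$ and all real $T$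 with $2\le T\le(\log X)^{1-\varepsilon}$ for which $r_\gamma\ne0$ for at least one $0<\gamma\le T$, $$\frac1X\,\mathrm{meas}\{t\in[1,X]: F(t,T)>c_1(\log T)^A\}\ \ge\ C e^{-c_2T\log T}$$ and $$\frac1X\,\mathrm{meas}\{t\in[1,X]: F(t,T)<-c_1(\log T)^A\}\ \ge\ C e^{-c_2T\log T},$$ where $\mathrm{meas}$ is Lebesgue measure. -/

import Mathlib

open Filter Asymptotics MeasureTheory

namespace ZetaSums

/-- The non-trivial zeros of the Riemann zeta function with imaginary part in `[0, T]`. -/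
def zeroSet (T : ℝ) : Set ℂ :=
  {ρ : ℂ | riemannZeta ρ = 0 ∧ 0 < ρ.re ∧ ρ.re < 1 ∧ 0 ≤ ρ.im ∧ ρ.im ≤ T}

theorem zeroSet_finite (T : ℝ) : (zeroSet T).Finite := by
  refine Set.Finite.subset (IsCompact.inter_riemannZetaZeros_finite
    ((isCompact_Icc (a := (0 : ℝ)) (b := 1)).reProdIm (isCompact_Icc (a := (0 : ℝ)) (b := T)))) ?_
  rintro ρ ⟨h0, h1, h2, h3, h4⟩
  exact ⟨Complex.mem_reProdIm.2 ⟨⟨h1.le, h2.le⟩, ⟨h3, h4⟩⟩, h0⟩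

/-- `N(T)`: the number of non-trivial zeros with imaginary part in `[0, T]`, counted with
multiplicity. -/
noncomputable def zeroCount (T : ℝ) : ℕ :=
  ∑ ρ ∈ (zeroSet_finite T).toFinset, analyticOrderNatAt riemannZeta ρ

/-- The finite set of the ordinates `γ` of non-trivial zeros with `0 < γ ≤ T`. -/
noncomputable def ordinates (T : ℝ) : Finset ℝ :=
  ((zeroSet_finite T).toFinset.image Complex.im).filter (fun γ => 0 < γ)

theorem mem_ordinates (T γ : ℝ) :
    γ ∈ ordinates T ↔ 0 < γ ∧ γ ≤ T ∧
      ∃ ρ : ℂ, riemannZeta ρ = 0 ∧ 0 < ρ.re ∧ ρ.re < 1 ∧ ρ.im = γ := by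
  simp only [ordinates, Finset.mem_filter, Finset.mem_image, Set.Finite.mem_toFinset, zeroSet,
    Set.mem_ofPred_eq]
  constructor
  · rintro ⟨⟨ρ, ⟨h0, h1, h2, _, h4⟩, rfl⟩, hγ⟩
    exact ⟨hγ, h4, ρ, h0, h1, h2, rfl⟩
  · rintro ⟨hγ, hT, ρ, h0, h1, h2, rfl⟩
    exact ⟨⟨ρ, ⟨h0, h1, h2, hγ.le, hT⟩, rfl⟩, hγ⟩

/-- The Effective LI conjecture. -/
def EffectiveLI : Prop :=
  ∀ ε : ℝ, 0 < ε → ∃ C : ℝ, 0 < C ∧ ∀ T : ℝ, 2 ≤ T → ∀ l : ℝ → ℤ,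
    (∃ γ ∈ ordinates T, l γ ≠ 0) → (∀ γ ∈ ordinates T, |l γ| ≤ (zeroCount T : ℤ)) →
      C * Real.exp (-T ^ (1 + ε)) ≤ |∑ γ ∈ ordinates T, (l γ : ℝ) * γ|

/-- `H(T) = ∑_{0 < γ ≤ T} |r_γ|`. Only the values of `r` at the ordinates matter. -/
noncomputable def coeffSum (r : ℝ → ℂ) (T : ℝ) : ℝ := ∑ γ ∈ ordinates T, ‖r γ‖

/-- `H(T) ≍ (log T)^A` as `T → ∞`. -/
def CoeffGrowth (r : ℝ → ℂ) (A : ℝ) : Prop :=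
  coeffSum r =Θ[atTop] fun T : ℝ => Real.log T ^ A

/-- `F(t, T) = ∑_{0 < γ ≤ T} |r_γ| cos(γ t + arg r_γ)`. -/
noncomputable def shortSum (r : ℝ → ℂ) (t T : ℝ) : ℝ :=
  ∑ γ ∈ ordinates T, Real.cos (γ * t + Complex.arg (r γ)) * ‖r γ‖

/-- `F(t, T)` is the real part of `∑_{0 < γ ≤ T} x^{iγ} r_γ` at `x = e^t`. -/
theorem shortSum_eq_re (r : ℝ → ℂ) (t T : ℝ) :
    shortSum r t T = (∑ γ ∈ ordinates T, Complex.exp (Complex.I * γ * t) * r γ).re := by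
  rw [shortSum, Complex.re_sum]
  refine Finset.sum_congr rfl fun γ _ => ?_
  conv_rhs => rw [← Complex.norm_mul_exp_arg_mul_I (r γ)]
  rw [mul_left_comm, ← Complex.exp_add, Complex.re_ofReal_mul,
    show Complex.I * γ * t + Complex.arg (r γ) * Complex.I
      = ((γ * t + Complex.arg (r γ) : ℝ) : ℂ) * Complex.I by push_cast; ring,
    Complex.exp_ofReal_mul_I_re, mul_comm]

end ZetaSums

/-! Let `S` be the set of ordinates up to `T`, `H` the sum of the `|r_γ|`, and weight `t ∈ [1, X]`
by the Riesz product `P(t) = ∏ (1 + cos(γt + θ_γ))`, where `0 ≤ P ≤ 2^|S|`. Its frequencies are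
combinations of `S` with coefficients in `{-1, 0, 1}`; multiplying by `cos(γt + θ_γ)` raises one
coefficient to at most 2. If every nontrivial such combination is at least `m` in size, the
oscillating terms contribute `O(2^|S| / m)`, so `P` has mean about 1 and `cos(γt + θ_γ) P` mean
about 1/2 (`abs_integral_rieszProduct_sub_le`, `le_integral_cos_mul_rieszProduct`). With `θ_γ = arg
r_γ`, the weighted mean of `F` is about `H / 2`. Values `F ≤ H / 4` account for only half of it, so
the rest comes from the set where `F > H / 4`, whose measure is therefore about `X / (4 · 2^|S|)` or
more. Effective LI supplies `m = C exp(-T^(1+ε))`, making the error `X^o(1)` in the given range of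
`T`. The bound `|S| = O(T log T)` turns `2^|S|` into the stated exponential; it follows from
Jensen's inequality for `(s - 1) ζ(s)`. -/

namespace ZetaSums

/-! ### Polynomial growth of `(s - 1) ζ(s)` for `re s > 1/5` -/

/-- The `n`-th term of the series `∑ (s - 1) ∫_{n+1}^{n+2} ((n + 1)^{-s} - x^{-s}) dx`, which
represents `(s - 1) ζ(s) - 1` in the half plane `0 < re s`. -/
noncomputable def zetaTerm (n : ℕ) (s : ℂ) : ℂ :=
  (s - 1) * ((n + 1 : ℝ) : ℂ) ^ (-s) +
    (((n + 2 : ℝ) : ℂ) ^ (1 - s) - ((n + 1 : ℝ) : ℂ) ^ (1 - s))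

theorem differentiable_zetaTerm (n : ℕ) : Differentiable ℂ (zetaTerm n) := by
  have h1 : ((n + 1 : ℝ) : ℂ) ≠ 0 := by exact_mod_cast (by positivity : (n + 1 : ℝ) ≠ 0)
  have h2 : ((n + 2 : ℝ) : ℂ) ≠ 0 := by exact_mod_cast (by positivity : (n + 2 : ℝ) ≠ 0)
  have e (a : ℂ) (ha : a ≠ 0) (f : ℂ → ℂ) (hf : Differentiable ℂ f) :
      Differentiable ℂ fun s => a ^ f s := hf.const_cpow (Or.inl ha)
  unfold zetaTerm
  exact ((differentiable_id.sub_const 1).mul (e _ h1 _ differentiable_neg)).add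
    ((e _ h2 _ (by fun_prop)).sub (e _ h1 _ (by fun_prop)))

theorem norm_cpow_neg_sub_le {a x : ℝ} (ha : 0 < a) (hx : x ∈ Set.Icc a (a + 1)) {s : ℂ}
    (hs : 0 < s.re) :
    ‖(x : ℂ) ^ (-s) - (a : ℂ) ^ (-s)‖ ≤ ‖s‖ * a ^ (-s.re - 1) := by
  have hs0 : -s ≠ 0 := by
    rw [neg_ne_zero]; rintro rfl; simp at hs
  have key := norm_image_sub_le_of_norm_deriv_le_segment' (a := a) (b := a + 1)
    (f := fun y : ℝ => (y : ℂ) ^ (-s)) (f' := fun y : ℝ => -s * (y : ℂ) ^ (-s - 1))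
    (C := ‖s‖ * a ^ (-s.re - 1))
    (fun y hy => (hasDerivAt_ofReal_cpow_const (ha.trans_le hy.1).ne' hs0).hasDerivWithinAt)
    (fun y hy => by
      rw [norm_mul, norm_neg, Complex.norm_cpow_eq_rpow_re_of_pos (ha.trans_le hy.1)]
      refine mul_le_mul_of_nonneg_left ?_ (norm_nonneg _)
      simpa using Real.rpow_le_rpow_of_nonpos ha hy.1 (by linarith : -s.re - 1 ≤ 0)) x hx
  refine key.trans ?_
  have : 0 ≤ ‖s‖ * a ^ (-s.re - 1) := by positivity
  nlinarith [hx.2]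

/-- The term is the increment over `[a, a + 1]` of `y ↦ (s - 1) a^(-s) y + y^(1 - s)`. The
derivative of this function is itself a difference of values of `y^(-s)`, so a second mean value
bound gains the power of `n` needed for convergence. -/
theorem norm_zetaTerm_le (n : ℕ) {s : ℂ} (hs : 0 < s.re) :
    ‖zetaTerm n s‖ ≤ ‖s - 1‖ * ‖s‖ * (n + 1 : ℝ) ^ (-s.re - 1) := by
  rcases eq_or_ne s 1 with rfl | hs1
  · simp [zetaTerm]
  set a : ℝ := n + 1 with ha_def
  have ha : 0 < a := by positivity
  have hs0 : 1 - s ≠ 0 := sub_ne_zero.2 hs1.symm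
  have key := norm_image_sub_le_of_norm_deriv_le_segment' (a := a) (b := a + 1)
    (f := fun y : ℝ => (s - 1) * (a : ℂ) ^ (-s) * (y : ℂ) + (y : ℂ) ^ (1 - s))
    (f' := fun y : ℝ => (s - 1) * (a : ℂ) ^ (-s) * 1 + (1 - s) * (y : ℂ) ^ (1 - s - 1))
    (C := ‖s - 1‖ * ‖s‖ * a ^ (-s.re - 1))
    (fun y hy => ((Complex.ofRealCLM.hasDerivAt.const_mul _).add
      (hasDerivAt_ofReal_cpow_const (ha.trans_le hy.1).ne' hs0)).hasDerivWithinAt)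
    (fun y hy => by
      rw [show (s - 1) * (a : ℂ) ^ (-s) * 1 + (1 - s) * (y : ℂ) ^ (1 - s - 1)
        = -(s - 1) * ((y : ℂ) ^ (-s) - (a : ℂ) ^ (-s)) by
          rw [show 1 - s - 1 = -s by ring]; ring, norm_mul, norm_neg, mul_assoc]
      exact mul_le_mul_of_nonneg_left
        (norm_cpow_neg_sub_le ha ⟨hy.1, hy.2.le⟩ hs) (norm_nonneg _)) (a + 1)
    ⟨by linarith, le_rfl⟩
  rw [show a + 1 - a = 1 by ring, mul_one] at key
  refine le_of_eq_of_le (congrArg norm ?_) key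
  have : a + 1 = n + 2 := by rw [ha_def]; ring
  rw [zetaTerm, ← ha_def, ← this]
  push_cast
  ring

theorem summable_rpow_neg_six_fifths : Summable fun n : ℕ => (n + 1 : ℝ) ^ (-(6 / 5) : ℝ) := by
  have := (summable_nat_add_iff 1).2 (Real.summable_nat_rpow (p := -(6 / 5)).2 (by norm_num))
  exact_mod_cast this

theorem norm_zetaTerm_le_of_le (n : ℕ) {s : ℂ} (hs : 1 / 5 ≤ s.re) :
    ‖zetaTerm n s‖ ≤ ‖s - 1‖ * ‖s‖ * (n + 1 : ℝ) ^ (-(6 / 5) : ℝ) := by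
  refine (norm_zetaTerm_le n (by linarith)).trans ?_
  refine mul_le_mul_of_nonneg_left ?_ (by positivity)
  exact Real.rpow_le_rpow_of_exponent_le (by linarith [n.cast_nonneg (α := ℝ)]) (by linarith)

theorem tendsto_natCast_cpow_zero {s : ℂ} (hs : s.re < 0) :
    Tendsto (fun n : ℕ => ((n + 1 : ℝ) : ℂ) ^ s) atTop (nhds 0) := by
  rw [tendsto_zero_iff_norm_tendsto_zero]
  have h1 : Tendsto (fun n : ℕ => (n + 1 : ℝ)) atTop atTop :=
    tendsto_atTop_add_const_right _ _ tendsto_natCast_atTop_atTop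
  have := (tendsto_rpow_neg_atTop (by linarith : 0 < -s.re)).comp h1
  refine this.congr fun n => ?_
  rw [Complex.norm_cpow_eq_rpow_re_of_pos (by positivity)]
  simp

theorem riemannZeta₁_eq_mul {s : ℂ} (hs : s ≠ 1) :
    riemannZeta₁ s = (s - 1) * riemannZeta s := by
  rw [riemannZeta_eq_inv_sub_mul hs, mul_inv_cancel_left₀ (sub_ne_zero.2 hs)]

theorem riemannZeta₁_eq_of_one_lt_re {s : ℂ} (hs : 1 < s.re) :
    riemannZeta₁ s = 1 + ∑' n, zetaTerm n s := by
  have hs1 : s ≠ 1 := by rintro rfl; simp at hs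
  have hsum : HasSum (fun n : ℕ => ((n + 1 : ℝ) : ℂ) ^ (-s)) (riemannZeta s) := by
    rw [zeta_eq_tsum_one_div_nat_add_one_cpow hs]
    have h := (summable_nat_add_iff 1).2 (Complex.summable_one_div_nat_cpow.2 hs)
    have e : (fun n : ℕ => ((n + 1 : ℝ) : ℂ) ^ (-s)) = fun n : ℕ => 1 / (n + 1 : ℂ) ^ s := by
      funext n; rw [Complex.cpow_neg, one_div]; push_cast; rfl
    rw [e]
    exact (by exact_mod_cast h : Summable fun n : ℕ => 1 / (n + 1 : ℂ) ^ s).hasSum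
  have hterm : Summable fun n => zetaTerm n s :=
    Summable.of_norm_bounded (summable_rpow_neg_six_fifths.mul_left (‖s - 1‖ * ‖s‖))
      fun n => norm_zetaTerm_le_of_le n (by linarith)
  have lim1 := (hsum.mul_left (s - 1)).tendsto_sum_nat
  have lim2 := tendsto_natCast_cpow_zero (s := 1 - s) (by simpa using hs)
  have lim3 : Tendsto (fun N : ℕ => ∑ n ∈ Finset.range N, zetaTerm n s) atTop
      (nhds ((s - 1) * riemannZeta s + (0 - 1))) := by
    refine (lim1.add (lim2.sub_const 1)).congr fun N => ?_
    have tel := Finset.sum_range_sub (fun n : ℕ => ((n + 1 : ℝ) : ℂ) ^ (1 - s)) N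
    simp only [zetaTerm, Finset.sum_add_distrib]
    congr 1
    rw [Nat.cast_zero, zero_add, Complex.ofReal_one, Complex.one_cpow] at tel
    rw [← tel]
    refine Finset.sum_congr rfl fun n _ => ?_
    congr 3
    push_cast
    ring
  rw [tendsto_nhds_unique hterm.hasSum.tendsto_sum_nat lim3, riemannZeta₁_eq_mul hs1]
  ring

theorem riemannZeta₁_eq_tsum {s : ℂ} (hs : 1 / 5 < s.re) :
    riemannZeta₁ s = 1 + ∑' n, zetaTerm n s := by
  -- The term bound grows with `s`, so the identity theorem is applied on a bounded convex piece of
  -- the half plane; the radius makes it contain both `s` and the base point 2.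
  set R : ℝ := ‖s‖ + 3 with hR
  set U : Set ℂ := {z | 1 / 5 < z.re} ∩ Metric.ball 0 R with hU
  have hRpos : 0 < R := by positivity
  have hUo : IsOpen U := (isOpen_lt continuous_const Complex.continuous_re).inter Metric.isOpen_ball
  have hUc : Convex ℝ U := (convex_halfSpace_re_gt _).inter (convex_ball _ _)
  have hdiff : DifferentiableOn ℂ (fun z => ∑' n, zetaTerm n z) U := by
    refine Complex.differentiableOn_tsum_of_summable_norm
      (u := fun n : ℕ => (R + 1) * R * (n + 1 : ℝ) ^ (-(6 / 5) : ℝ))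
      (summable_rpow_neg_six_fifths.mul_left _)
      (fun n => (differentiable_zetaTerm n).differentiableOn) hUo fun n z hz => ?_
    have hz' : ‖z‖ ≤ R := (mem_ball_zero_iff.1 hz.2).le
    have : ‖z - 1‖ ≤ R + 1 := (norm_sub_le _ _).trans (by simpa using hz')
    refine (norm_zetaTerm_le_of_le n (le_of_lt hz.1)).trans ?_
    gcongr
  have h1 : AnalyticOnNhd ℂ riemannZeta₁ U :=
    differentiable_riemannZeta₁.differentiableOn.analyticOnNhd hUo
  have h2 : AnalyticOnNhd ℂ (fun z => 1 + ∑' n, zetaTerm n z) U :=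
    ((differentiableOn_const 1).add hdiff).analyticOnNhd hUo
  have h2U : (2 : ℂ) ∈ U := by
    refine ⟨by norm_num, ?_⟩
    rw [mem_ball_zero_iff, hR]
    norm_num
    linarith [norm_nonneg s]
  refine h1.eqOn_of_preconnected_of_eventuallyEq h2 hUc.isPreconnected h2U ?_ ⟨hs, ?_⟩
  · filter_upwards [(isOpen_lt continuous_const Complex.continuous_re).mem_nhds
      (show (1 : ℝ) < (2 : ℂ).re by norm_num)] with z hz
    exact riemannZeta₁_eq_of_one_lt_re hz
  · rw [mem_ball_zero_iff]; linarith

theorem exists_norm_riemannZeta₁_le :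
    ∃ K : ℝ, 0 ≤ K ∧ ∀ s : ℂ, 1 / 5 < s.re → ‖riemannZeta₁ s‖ ≤ 1 + K * (‖s - 1‖ * ‖s‖) := by
  refine ⟨∑' n : ℕ, (n + 1 : ℝ) ^ (-(6 / 5) : ℝ), tsum_nonneg fun n => by positivity,
    fun s hs => ?_⟩
  rw [riemannZeta₁_eq_tsum hs, mul_comm, ← tsum_mul_left]
  refine (norm_add_le _ _).trans ?_
  rw [norm_one]
  gcongr
  exact tsum_of_norm_bounded (summable_rpow_neg_six_fifths.mul_left _).hasSum
    fun n => norm_zetaTerm_le_of_le n hs.le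

/-! ### Counting ordinates with Jensen's inequality -/

/-- Jensen's inequality bounds the zeros with multiplicity, and each point of `Z` has multiplicity
at least one. -/
theorem card_zeros_le {f : ℂ → ℂ} (hf : Differentiable ℂ f) {c : ℂ} (hc : f c ≠ 0) {r R M : ℝ}
    (hr : 0 < r) (hrR : r < R) (hM : 1 ≤ M) (hfM : ∀ z ∈ Metric.sphere c R, ‖f z‖ ≤ M)
    (Z : Finset ℂ) (hZ : ∀ z ∈ Z, f z = 0 ∧ z ∈ Metric.closedBall c r) :
    (Z.card : ℝ) ≤ Real.log (M / ‖f c‖) / Real.log (R / r) := by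
  have han : AnalyticOnNhd ℂ f Set.univ := hf.differentiableOn.analyticOnNhd isOpen_univ
  have key := AnalyticOnNhd.sum_divisor_le (c := c) (r := r) (R := R) (M := M) (f := f)
    (by positivity) (by rwa [abs_of_pos hr, abs_of_pos (hr.trans hrR)]) hM
    (han.mono (Set.subset_univ _)) hc (by rwa [abs_of_pos (hr.trans hrR)])
  rw [abs_of_pos hr] at key
  refine le_trans ?_ key
  set D := MeromorphicOn.divisor f (Metric.closedBall c r) with hD
  have hball : AnalyticOnNhd ℂ f (Metric.closedBall c r) := han.mono (Set.subset_univ _)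
  have hD0 : ∀ u, 0 ≤ D u := fun u => MeromorphicOn.AnalyticOnNhd.divisor_nonneg hball u
  have hfin : (Function.support D).Finite := D.finiteSupport (isCompact_closedBall _ _)
  have hone : ∀ z ∈ Z, 1 ≤ D z := fun z hz => by
    obtain ⟨hz0, hzb⟩ := hZ z hz
    have htop : analyticOrderAt f z ≠ ⊤ := fun h => hc <|
      han.eqOn_zero_of_preconnected_of_eventuallyEq_zero isPreconnected_univ (Set.mem_univ z)
        (analyticOrderAt_eq_top.1 h) (Set.mem_univ c)
    have hne : analyticOrderAt f z ≠ 0 := fun h =>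
      ((han z (Set.mem_univ z)).analyticOrderAt_eq_zero.1 h) hz0
    have hne' : D z ≠ 0 := by
      rw [hD, MeromorphicOn.AnalyticOnNhd.divisor_apply hball hzb]
      obtain ⟨n, hn⟩ := ENat.ne_top_iff_exists.1 htop
      rw [← hn] at hne ⊢
      simpa using hne
    have := hD0 z
    omega
  rw [finsum_eq_sum_of_support_subset D (s := hfin.toFinset ∪ Z) (by simp)]
  have h1 : (Z.card : ℤ) ≤ ∑ z ∈ Z, D z := by
    simpa using Finset.card_nsmul_le_sum Z D 1 hone
  exact_mod_cast h1.trans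
    (Finset.sum_le_sum_of_subset_of_nonneg Finset.subset_union_right fun z _ _ => hD0 z)

/-- By the functional equation, every ordinate is that of a zero with `1 / 2 ≤ re`. -/
theorem exists_zero_half_le_re {T γ : ℝ} (h : γ ∈ ordinates T) :
    ∃ ρ : ℂ, riemannZeta ρ = 0 ∧ 1 / 2 ≤ ρ.re ∧ ρ.re < 1 ∧ ρ.im = γ := by
  obtain ⟨hγ, -, ρ, h0, h1, h2, rfl⟩ := (mem_ordinates T γ).1 h
  rcases le_total (1 / 2) ρ.re with h3 | h3
  · exact ⟨ρ, h0, h3, h2, rfl⟩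
  · refine ⟨1 - (starRingEnd ℂ) ρ, ?_, ?_, ?_, by simp⟩
    · rw [riemannZeta_one_sub, riemannZeta_conj, h0]
      · simp
      · intro n hn
        have := congrArg Complex.re hn
        simp at this
        linarith [n.cast_nonneg (α := ℝ)]
      · intro hn
        have := congrArg Complex.re hn
        simp at this
        linarith
    · simp; linarith
    · simpa using h1

theorem exists_le_norm_riemannZeta₁ :
    ∃ a : ℝ, 0 < a ∧ ∀ s : ℂ, s.re = 2 → a ≤ ‖riemannZeta₁ s‖ := by
  have hpi : Real.pi ^ 2 / 6 < 2 := by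
    nlinarith [Real.pi_lt_d2, Real.pi_pos]
  refine ⟨2 - Real.pi ^ 2 / 6, by linarith, fun s hs => ?_⟩
  have hs1 : s ≠ 1 := by rintro rfl; simp at hs
  have hre : 1 < s.re := by rw [hs]; norm_num
  have hnorm : ∀ n : ℕ, ‖1 / (n : ℂ) ^ s‖ ≤ 1 / (n : ℝ) ^ 2 := fun n => by
    rcases Nat.eq_zero_or_pos n with rfl | hn
    · rw [Nat.cast_zero, Complex.zero_cpow (by rintro rfl; simp at hs)]; simp
    · rw [norm_div, norm_one, Complex.norm_natCast_cpow_of_pos hn, hs]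
      norm_num
  have hsum : HasSum (fun n : ℕ => 1 / (n : ℂ) ^ s) (riemannZeta s) := by
    rw [zeta_eq_tsum_one_div_nat_cpow hre]
    exact (Complex.summable_one_div_nat_cpow.2 hre).hasSum
  -- Comparison with the series of `ζ(2)` after removing the terms `n = 0` and `n = 1`.
  have h2 : ‖riemannZeta s - 1‖ ≤ Real.pi ^ 2 / 6 - 1 := by
    have e1 := (hasSum_nat_add_iff' 2).2 hsum
    have e2 := (hasSum_nat_add_iff' 2).2 hasSum_zeta_two
    have hs0 : s ≠ 0 := by rintro rfl; simp at hs
    simp [Finset.sum_range_succ, Complex.zero_cpow hs0] at e1 e2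
    refine HasSum.norm_le_of_bounded e1 e2 fun n => ?_
    simpa using hnorm (n + 2)
  have h3 : 2 - Real.pi ^ 2 / 6 ≤ ‖riemannZeta s‖ := by
    have := norm_sub_norm_le (1 : ℂ) (1 - riemannZeta s)
    rw [sub_sub_cancel, norm_one, norm_sub_rev] at this
    linarith
  have h4 : 1 ≤ ‖s - 1‖ := by
    refine le_trans ?_ (Complex.abs_re_le_norm _)
    simp [hs]; norm_num
  rw [riemannZeta₁_eq_mul hs1, norm_mul]
  nlinarith [norm_nonneg (riemannZeta s)]

/-- The number of ordinates in a bounded interval around `k` is `O(log k)`. -/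
theorem exists_card_ordinates_near_le :
    ∃ B : ℝ, 0 ≤ B ∧ ∀ (T : ℝ) (k : ℕ),
      (((ordinates T).filter fun γ => ⌊γ⌋₊ = k).card : ℝ) ≤ B * Real.log (k + 2) := by
  obtain ⟨K, hK0, hK⟩ := exists_norm_riemannZeta₁_le
  obtain ⟨a, ha0, ha⟩ := exists_le_norm_riemannZeta₁
  set L : ℝ := Real.log ((7 / 4) / (17 / 10)) with hL
  have hL0 : 0 < L := Real.log_pos (by norm_num)
  set b : ℝ := |Real.log ((1 + 16 * K) / a)| with hb
  have hlog2 : 0 < Real.log 2 := Real.log_pos (by norm_num)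
  refine ⟨(b / Real.log 2 + 2) / L, by positivity, fun T k => ?_⟩
  set S := (ordinates T).filter fun γ => ⌊γ⌋₊ = k with hS
  have hex : ∀ γ ∈ S, ∃ ρ : ℂ, riemannZeta ρ = 0 ∧ 1 / 2 ≤ ρ.re ∧ ρ.re < 1 ∧ ρ.im = γ :=
    fun γ hγ => exists_zero_half_le_re (Finset.mem_filter.1 hγ).1
  choose! z hz using hex
  have hinj : Set.InjOn z S := fun x hx y hy hxy => by
    rw [← (hz x hx).2.2.2, hxy, (hz y hy).2.2.2]
  -- Zeros with `1/2 ≤ re < 1` and `k ≤ im < k + 1` lie within `√(5/2) < 17/10` of `c`, while the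
  -- circle of radius `7/4` stays in `re ≥ 1/4`, where the growth bound holds.
  set c : ℂ := ⟨2, k + 1 / 2⟩ with hc
  have hac := ha c rfl
  have hM : 1 ≤ (1 + 16 * K) * (k + 2 : ℝ) ^ 2 := by
    have : (0 : ℝ) ≤ k := k.cast_nonneg
    nlinarith [mul_nonneg hK0 (sq_nonneg ((k : ℝ) + 2))]
  have key := card_zeros_le differentiable_riemannZeta₁ (c := c) (r := 17 / 10) (R := 7 / 4)
    (M := (1 + 16 * K) * (k + 2 : ℝ) ^ 2)
    (norm_pos_iff.1 (ha0.trans_le hac)) (by norm_num) (by norm_num) hM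
    (fun w hw => ?_) (S.image z) (fun w hw => ?_)
  · rw [Finset.card_image_of_injOn hinj] at key
    refine key.trans ?_
    rw [← hL, div_mul_eq_mul_div]
    refine div_le_div_of_nonneg_right ?_ hL0.le
    have h1 : Real.log ((1 + 16 * K) * (k + 2 : ℝ) ^ 2 / ‖riemannZeta₁ c‖)
        ≤ Real.log ((1 + 16 * K) / a * (k + 2 : ℝ) ^ 2) := by
      refine Real.log_le_log (div_pos (by positivity) (ha0.trans_le hac)) ?_
      rw [div_mul_eq_mul_div]
      gcongr
    refine h1.trans ?_
    rw [Real.log_mul (by positivity) (by positivity), Real.log_pow, add_mul]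
    have h2 : b ≤ b / Real.log 2 * Real.log (k + 2) := by
      rw [div_mul_eq_mul_div, le_div_iff₀ hlog2]
      refine mul_le_mul_of_nonneg_left ?_ (abs_nonneg _)
      exact Real.log_le_log (by norm_num) (by linarith [k.cast_nonneg (α := ℝ)])
    push_cast
    linarith [le_abs_self (Real.log ((1 + 16 * K) / a))]
  · have hw' : ‖w - c‖ = 7 / 4 := by simpa [dist_eq_norm] using hw
    have hre : |w.re - 2| ≤ 7 / 4 := by
      rw [← hw']; simpa [hc] using Complex.abs_re_le_norm (w - c)
    have hcn : ‖c‖ ≤ k + 5 / 2 := by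
      refine (Complex.norm_le_abs_re_add_abs_im c).trans ?_
      rw [hc, abs_of_pos (by norm_num : (0 : ℝ) < 2), abs_of_pos (by positivity)]
      linarith
    have hwn : ‖w‖ ≤ k + 5 := by
      have := norm_add_le (w - c) c
      rw [sub_add_cancel] at this
      linarith
    have hw1 : ‖w - 1‖ ≤ k + 6 := by
      have := norm_sub_le w 1
      rw [norm_one] at this
      linarith
    refine (hK w (by linarith [(abs_le.1 hre).1])).trans ?_
    have hkk : (0 : ℝ) ≤ k := k.cast_nonneg
    have h3 : ‖w - 1‖ * ‖w‖ ≤ (k + 6) * (k + 5) := by gcongr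
    have h4 : ((k : ℝ) + 6) * (k + 5) ≤ 16 * (k + 2) ^ 2 := by nlinarith
    have h5 : K * (‖w - 1‖ * ‖w‖) ≤ K * (16 * (k + 2) ^ 2) :=
      mul_le_mul_of_nonneg_left (h3.trans h4) hK0
    nlinarith
  · obtain ⟨γ, hγ, rfl⟩ := Finset.mem_image.1 hw
    obtain ⟨h0, h1, h2, h3⟩ := hz γ hγ
    obtain ⟨hγT, hfl⟩ := Finset.mem_filter.1 hγ
    have hγ0 := ((mem_ordinates T γ).1 hγT).1
    have hne : z γ ≠ 1 := fun h => by rw [h] at h2; simp at h2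
    refine ⟨by rw [riemannZeta₁_eq_mul hne, h0, mul_zero], ?_⟩
    have hlo := Nat.floor_le hγ0.le
    have hhi := Nat.lt_floor_add_one γ
    rw [hfl] at hlo hhi
    rw [mem_closedBall_iff_norm, ← abs_of_pos (by norm_num : (0 : ℝ) < 17 / 10),
      ← sq_le_sq₀ (norm_nonneg _) (abs_nonneg _), ← Complex.normSq_eq_norm_sq,
      Complex.normSq_apply]
    simp only [hc, Complex.sub_re, Complex.sub_im, h3]
    norm_num
    nlinarith

theorem exists_card_ordinates_le :
    ∃ c : ℝ, 0 < c ∧ ∀ T : ℝ, 2 ≤ T → ((ordinates T).card : ℝ) ≤ c * (T * Real.log T) := by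
  obtain ⟨B, hB0, hB⟩ := exists_card_ordinates_near_le
  refine ⟨4 * B + 1, by positivity, fun T hT => ?_⟩
  have hlog : 0 < Real.log T := Real.log_pos (by linarith)
  have hmaps : ∀ γ ∈ ordinates T, ⌊γ⌋₊ ∈ Finset.range (⌊T⌋₊ + 1) := fun γ hγ =>
    Finset.mem_range.2 (Nat.lt_succ_of_le (Nat.floor_le_floor ((mem_ordinates T γ).1 hγ).2.1))
  rw [Finset.card_eq_sum_card_fiberwise hmaps]
  push_cast
  have hT' := Nat.floor_le (by linarith : (0 : ℝ) ≤ T)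
  have hk : ∀ k ∈ Finset.range (⌊T⌋₊ + 1),
      (((ordinates T).filter fun γ => ⌊γ⌋₊ = k).card : ℝ) ≤ B * (2 * Real.log T) := by
    intro k hk
    refine (hB T k).trans (mul_le_mul_of_nonneg_left ?_ hB0)
    have : (k : ℝ) ≤ T :=
      (Nat.cast_le.2 (Nat.le_of_lt_succ (Finset.mem_range.1 hk))).trans hT'
    rw [← Real.log_rpow (by linarith), Real.rpow_two]
    exact Real.log_le_log (by positivity) (by nlinarith)
  refine (Finset.sum_le_sum hk).trans ?_
  rw [Finset.sum_const, Finset.card_range, nsmul_eq_mul]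
  push_cast
  have h1 : (⌊T⌋₊ + 1 : ℝ) ≤ 2 * T := by linarith
  calc (⌊T⌋₊ + 1 : ℝ) * (B * (2 * Real.log T)) ≤ 2 * T * (B * (2 * Real.log T)) := by gcongr
    _ ≤ (4 * B + 1) * (T * Real.log T) := by
      have : 0 ≤ T * Real.log T := by positivity
      nlinarith

/-! ### Riesz products and their means -/

/-- The Riesz product `∏_{γ ∈ S} (1 + cos (γ t + θ_γ))`. -/
noncomputable def rieszProduct (θ : ℝ → ℝ) (S : Finset ℝ) (t : ℝ) : ℝ :=
  ∏ γ ∈ S, (1 + Real.cos (γ * t + θ γ))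

theorem continuous_rieszProduct (θ : ℝ → ℝ) (S : Finset ℝ) : Continuous (rieszProduct θ S) := by
  unfold rieszProduct
  fun_prop

theorem rieszProduct_nonneg (θ : ℝ → ℝ) (S : Finset ℝ) (t : ℝ) : 0 ≤ rieszProduct θ S t :=
  Finset.prod_nonneg fun γ _ => by linarith [Real.neg_one_le_cos (γ * t + θ γ)]

theorem rieszProduct_le (θ : ℝ → ℝ) (S : Finset ℝ) (t : ℝ) :
    rieszProduct θ S t ≤ 2 ^ S.card := by
  rw [← Finset.prod_const]
  exact Finset.prod_le_prod (fun γ _ => by linarith [Real.neg_one_le_cos (γ * t + θ γ)])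
    fun γ _ => by linarith [Real.cos_le_one (γ * t + θ γ)]

theorem rieszProduct_insert (θ : ℝ → ℝ) {S : Finset ℝ} {a : ℝ} (ha : a ∉ S) (t : ℝ) :
    rieszProduct θ (insert a S) t = (1 + Real.cos (a * t + θ a)) * rieszProduct θ S t :=
  Finset.prod_insert ha

theorem sum_insert_update {S : Finset ℝ} {a : ℝ} (ha : a ∉ S) (l : ℝ → ℤ) (j : ℤ) :
    ∑ γ ∈ insert a S, (Function.update l a j γ : ℝ) * γ = j * a + ∑ γ ∈ S, (l γ : ℝ) * γ := by
  rw [Finset.sum_insert ha, Function.update_self]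
  congr 1
  refine Finset.sum_congr rfl fun γ hγ => ?_
  rw [Function.update_of_ne (by rintro rfl; exact ha hγ)]

theorem abs_update_le {l : ℝ → ℤ} {a : ℝ} {j b : ℤ} (hl : ∀ γ, |l γ| ≤ b) (hj : |j| ≤ b) (γ : ℝ) :
    |Function.update l a j γ| ≤ b := by
  rcases eq_or_ne γ a with rfl | h
  · rwa [Function.update_self]
  · rw [Function.update_of_ne h]; exact hl γ

theorem abs_integral_cos_le {x m : ℝ} (hm : 0 < m) (hx : m ≤ |x|) (φ a b : ℝ) :
    |∫ t in a..b, Real.cos (x * t + φ)| ≤ 2 / m := by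
  have hx0 : x ≠ 0 := by rintro rfl; simp at hx; linarith
  rw [intervalIntegral.integral_comp_mul_add _ hx0, integral_cos, smul_eq_mul, abs_mul, abs_inv,
    inv_mul_eq_div]
  refine div_le_div₀ (by norm_num) ?_ hm hx
  rw [abs_le]
  constructor <;> linarith [Real.neg_one_le_sin (x * b + φ), Real.sin_le_one (x * b + φ),
    Real.neg_one_le_sin (x * a + φ), Real.sin_le_one (x * a + φ)]

theorem intervalIntegrable_cos_mul_rieszProduct (θ : ℝ → ℝ) (S : Finset ℝ) (x φ a b : ℝ) :
    IntervalIntegrable (fun t => Real.cos (x * t + φ) * rieszProduct θ S t) volume a b :=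
  ((by fun_prop : Continuous fun t : ℝ => Real.cos (x * t + φ)).mul
    (continuous_rieszProduct θ S)).intervalIntegrable _ _

theorem integral_cos_mul_rieszProduct_insert (θ : ℝ → ℝ) {S : Finset ℝ} {a : ℝ} (ha : a ∉ S)
    (x φ u v : ℝ) :
    ∫ t in u..v, Real.cos (x * t + φ) * rieszProduct θ (insert a S) t =
      (∫ t in u..v, Real.cos (x * t + φ) * rieszProduct θ S t) +
        ((∫ t in u..v, Real.cos ((x + a) * t + (φ + θ a)) * rieszProduct θ S t) / 2 +
          (∫ t in u..v, Real.cos ((x - a) * t + (φ - θ a)) * rieszProduct θ S t) / 2) := by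
  rw [← intervalIntegral.integral_div, ← intervalIntegral.integral_div,
    ← intervalIntegral.integral_add, ← intervalIntegral.integral_add]
  · refine intervalIntegral.integral_congr fun t _ => ?_
    simp only [rieszProduct_insert θ ha]
    rw [show (x + a) * t + (φ + θ a) = (x * t + φ) + (a * t + θ a) by ring,
      show (x - a) * t + (φ - θ a) = (x * t + φ) - (a * t + θ a) by ring,
      Real.cos_add (x * t + φ), Real.cos_sub (x * t + φ)]
    ring
  · exact intervalIntegrable_cos_mul_rieszProduct ..
  · exact ((intervalIntegrable_cos_mul_rieszProduct ..).div_const _).add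
      ((intervalIntegrable_cos_mul_rieszProduct ..).div_const _)
  · exact (intervalIntegrable_cos_mul_rieszProduct ..).div_const _
  · exact (intervalIntegrable_cos_mul_rieszProduct ..).div_const _

/-- By induction on `S`: a new factor replaces the frequency `x` by `x`, `x + a`, `x - a` with
weights `1`, `1/2`, `1/2`, so the bound doubles. The hypothesis keeps all the resulting frequencies
away from zero. -/
theorem abs_integral_cos_mul_rieszProduct_le (θ : ℝ → ℝ) {m : ℝ} (hm : 0 < m) (u v : ℝ)
    (S : Finset ℝ) : ∀ x φ : ℝ,
      (∀ l : ℝ → ℤ, (∀ γ, |l γ| ≤ 1) → m ≤ |x + ∑ γ ∈ S, (l γ : ℝ) * γ|) →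
      |∫ t in u..v, Real.cos (x * t + φ) * rieszProduct θ S t| ≤ 2 ^ S.card * (2 / m) := by
  induction S using Finset.induction_on with
  | empty =>
    intro x φ h
    have hx := h 0 (by simp)
    simp only [Finset.sum_empty, add_zero] at hx
    simpa [rieszProduct] using abs_integral_cos_le hm hx φ u v
  | insert a S ha ih =>
    intro x φ h
    have step (j : ℤ) (hj : |j| ≤ 1) (l : ℝ → ℤ) (hl : ∀ γ, |l γ| ≤ 1) :
        m ≤ |x + (j * a + ∑ γ ∈ S, (l γ : ℝ) * γ)| := by
      rw [← sum_insert_update ha]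
      exact h _ (abs_update_le hl hj)
    have h0 := ih x φ fun l hl => by simpa using step 0 (by simp) l hl
    have h1 := ih (x + a) (φ + θ a) fun l hl => by simpa [add_assoc] using step 1 (by simp) l hl
    have h2 := ih (x - a) (φ - θ a) fun l hl => by
      simpa [add_assoc, sub_eq_add_neg] using step (-1) (by simp) l hl
    rw [integral_cos_mul_rieszProduct_insert θ ha, Finset.card_insert_of_notMem ha, pow_succ]
    rw [abs_le] at *
    constructor <;> linarith [h0.1, h0.2, h1.1, h1.2, h2.1, h2.2]

/-- Every nontrivial integer combination of `S` with coefficients at most `2` is at least `m` in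
absolute value. -/
def Nonresonant (m : ℝ) (S : Finset ℝ) : Prop :=
  ∀ l : ℝ → ℤ, (∀ γ, |l γ| ≤ 2) → (∃ γ ∈ S, l γ ≠ 0) → m ≤ |∑ γ ∈ S, (l γ : ℝ) * γ|

theorem Nonresonant.of_insert {m a : ℝ} {S : Finset ℝ} (ha : a ∉ S)
    (h : Nonresonant m (insert a S)) : Nonresonant m S := by
  rintro l hl ⟨γ, hγ, hlγ⟩
  have := h (Function.update l a 0) (abs_update_le hl (by simp))
    ⟨γ, Finset.mem_insert_of_mem hγ, by
      rwa [Function.update_of_ne (by rintro rfl; exact ha hγ)]⟩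
  rw [sum_insert_update ha] at this
  simpa using this

theorem Nonresonant.le_abs_add {m a : ℝ} {S : Finset ℝ} (ha : a ∉ S)
    (h : Nonresonant m (insert a S)) {j : ℤ} (hj : |j| ≤ 2) (hj0 : j ≠ 0)
    (l : ℝ → ℤ) (hl : ∀ γ, |l γ| ≤ 1) : m ≤ |j * a + ∑ γ ∈ S, (l γ : ℝ) * γ| := by
  rw [← sum_insert_update ha]
  exact h _ (abs_update_le (fun γ => (hl γ).trans (by norm_num)) hj)
    ⟨a, Finset.mem_insert_self _ _, by rwa [Function.update_self]⟩

theorem abs_integral_rieszProduct_sub_le (θ : ℝ → ℝ) {m : ℝ} (hm : 0 < m) (u v : ℝ)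
    {S : Finset ℝ} (h : Nonresonant m S) :
    |(∫ t in u..v, rieszProduct θ S t) - (v - u)| ≤ 2 ^ S.card * (2 / m) := by
  induction S using Finset.induction_on with
  | empty => simpa [rieszProduct] using by positivity
  | insert a S ha ih =>
    have h0 := ih (h.of_insert ha)
    have h1 := abs_integral_cos_mul_rieszProduct_le θ hm u v S a (θ a) fun l hl => by
      simpa using h.le_abs_add ha (j := 1) (by simp) one_ne_zero l hl
    have e : ∫ t in u..v, rieszProduct θ (insert a S) t = (∫ t in u..v, rieszProduct θ S t) +
        ∫ t in u..v, Real.cos (a * t + θ a) * rieszProduct θ S t := by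
      rw [← intervalIntegral.integral_add ((continuous_rieszProduct θ S).intervalIntegrable _ _)
        (intervalIntegrable_cos_mul_rieszProduct ..)]
      refine intervalIntegral.integral_congr fun t _ => ?_
      simp only [rieszProduct_insert θ ha]
      ring
    rw [e, Finset.card_insert_of_notMem ha, pow_succ]
    rw [abs_le] at *
    constructor <;> linarith [h0.1, h0.2, h1.1, h1.2]

/-- The main term comes from the factor of `a` itself: the square of its cosine has mean 1/2. The
remaining frequencies involve `a` or `2a`, which is why `Nonresonant` allows coefficients up to 2.
-/
theorem le_integral_cos_mul_rieszProduct (θ : ℝ → ℝ) {m : ℝ} (hm : 0 < m) (u v : ℝ)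
    {S : Finset ℝ} (h : Nonresonant m S) {a : ℝ} (haS : a ∈ S) :
    (v - u) / 2 - 2 ^ S.card * (2 / m) ≤
      ∫ t in u..v, Real.cos (a * t + θ a) * rieszProduct θ S t := by
  obtain ⟨S, ha, rfl⟩ : ∃ S', a ∉ S' ∧ insert a S' = S :=
    ⟨S.erase a, Finset.notMem_erase a S, Finset.insert_erase haS⟩
  have h0 := abs_integral_rieszProduct_sub_le θ hm u v (h.of_insert ha)
  have h1 := abs_integral_cos_mul_rieszProduct_le θ hm u v S a (θ a) fun l hl => by
    simpa using h.le_abs_add ha (j := 1) (by simp) one_ne_zero l hl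
  have h2 := abs_integral_cos_mul_rieszProduct_le θ hm u v S (a + a) (θ a + θ a) fun l hl => by
    simpa [two_mul] using h.le_abs_add ha (j := 2) (by simp) two_ne_zero l hl
  have e := integral_cos_mul_rieszProduct_insert θ ha a (θ a) u v
  simp only [sub_self, zero_mul, add_zero, Real.cos_zero, one_mul] at e
  rw [e, Finset.card_insert_of_notMem ha, pow_succ]
  rw [abs_le] at h0 h1 h2
  linarith [h0.1, h1.1, h2.1]

theorem le_measureReal_quarter_lt_sum_cos (θ w : ℝ → ℝ) {m : ℝ} (hm : 0 < m) {X : ℝ} (hX : 1 ≤ X)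
    {S : Finset ℝ} (h : Nonresonant m S) (hw : ∀ γ ∈ S, 0 ≤ w γ) (hpos : 0 < ∑ γ ∈ S, w γ) :
    (X - 1) / 4 - 5 / 4 * (2 ^ S.card * (2 / m)) ≤ 2 ^ S.card *
      volume.real {t : ℝ | t ∈ Set.Icc 1 X ∧
        (∑ γ ∈ S, w γ) / 4 < ∑ γ ∈ S, w γ * Real.cos (γ * t + θ γ)} := by
  set H := ∑ γ ∈ S, w γ with hH
  set G : ℝ → ℝ := fun t => ∑ γ ∈ S, w γ * Real.cos (γ * t + θ γ) with hG
  set P := rieszProduct θ S with hP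
  set E : ℝ := 2 ^ S.card * (2 / m) with hE
  set D : Set ℝ := {t : ℝ | t ∈ Set.Icc 1 X ∧ H / 4 < G t} with hD
  have hGc : Continuous G := by fun_prop
  have hPc : Continuous P := continuous_rieszProduct θ S
  have hDm : MeasurableSet D :=
    measurableSet_Icc.inter (isOpen_lt continuous_const hGc).measurableSet
  have hlower : H * ((X - 1) / 2 - E) ≤ ∫ t in (1 : ℝ)..X, G t * P t := by
    have e : ∫ t in (1 : ℝ)..X, G t * P t =
        ∑ γ ∈ S, w γ * ∫ t in (1 : ℝ)..X, Real.cos (γ * t + θ γ) * P t := by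
      simp only [← intervalIntegral.integral_const_mul]
      rw [← intervalIntegral.integral_finsetSum fun γ _ =>
        (intervalIntegrable_cos_mul_rieszProduct ..).const_mul _]
      refine intervalIntegral.integral_congr fun t _ => ?_
      simp only [hG, Finset.sum_mul, mul_assoc, hP]
    rw [e, hH, Finset.sum_mul]
    exact Finset.sum_le_sum fun γ hγ => mul_le_mul_of_nonneg_left
      (le_integral_cos_mul_rieszProduct θ hm 1 X h hγ) (hw γ hγ)
  have hind : ∫ t in (1 : ℝ)..X, D.indicator 1 t = volume.real D := by
    rw [intervalIntegral.integral_of_le hX, ← integral_Icc_eq_integral_Ioc,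
      integral_indicator_one hDm, measureReal_restrict_apply hDm,
      Set.inter_eq_left.2 fun t ht => ht.1]
  have hindi : IntervalIntegrable (D.indicator (1 : ℝ → ℝ)) volume 1 X := by
    rw [intervalIntegrable_iff]
    exact (integrableOn_const (C := (1 : ℝ)) (by simp)).indicator hDm
  -- Off `D` one has `G ≤ H / 4`; on `D` the trivial bounds `G ≤ H` and `P ≤ 2^|S|` are used.
  have hupper : ∫ t in (1 : ℝ)..X, G t * P t ≤
      ∫ t in (1 : ℝ)..X, (H / 4 * P t + H * 2 ^ S.card * D.indicator 1 t) := by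
    refine intervalIntegral.integral_mono_on hX ((hGc.mul hPc).intervalIntegrable _ _)
      (((hPc.intervalIntegrable _ _).const_mul _).add (hindi.const_mul _)) fun t ht => ?_
    have hP0 : 0 ≤ P t := rieszProduct_nonneg θ S t
    have hP1 : P t ≤ 2 ^ S.card := rieszProduct_le θ S t
    have hGH : G t ≤ H := Finset.sum_le_sum fun γ hγ =>
      mul_le_of_le_one_right (hw γ hγ) (Real.cos_le_one _)
    by_cases hGt : H / 4 < G t
    · rw [Set.indicator_of_mem (show t ∈ D from ⟨ht, hGt⟩), Pi.one_apply, mul_one]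
      have h1 : G t * P t ≤ H * P t := mul_le_mul_of_nonneg_right hGH hP0
      have h2 : H * P t ≤ H * 2 ^ S.card := mul_le_mul_of_nonneg_left hP1 hpos.le
      have h3 : 0 ≤ H / 4 * P t := by positivity
      linarith
    · rw [Set.indicator_of_notMem fun ht' : t ∈ D => hGt ht'.2, mul_zero, add_zero]
      exact mul_le_mul_of_nonneg_right (not_lt.1 hGt) hP0
  rw [intervalIntegral.integral_add ((hPc.intervalIntegrable _ _).const_mul _)
    (hindi.const_mul _), intervalIntegral.integral_const_mul,
    intervalIntegral.integral_const_mul, hind] at hupper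
  have hint := (abs_le.1 (abs_integral_rieszProduct_sub_le θ hm 1 X h)).2
  have hcomb : H * ((X - 1) / 2 - E) ≤
      H * ((X - 1 + E) / 4 + 2 ^ S.card * volume.real D) := by
    refine hlower.trans (hupper.trans ?_)
    have : H / 4 * ∫ t in (1 : ℝ)..X, P t ≤ H / 4 * (X - 1 + E) :=
      mul_le_mul_of_nonneg_left (by linarith) (by positivity)
    linarith
  have := le_of_mul_le_mul_left hcomb hpos
  linarith

/-! ### Inputs from Effective LI and from the growth of the coefficients -/

theorem one_le_analyticOrderNatAt {ρ : ℂ} (h0 : riemannZeta ρ = 0) (h1 : ρ ≠ 1) :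
    1 ≤ analyticOrderNatAt riemannZeta ρ := by
  have han : AnalyticOnNhd ℂ riemannZeta {1}ᶜ :=
    differentiableOn_riemannZeta.analyticOnNhd isOpen_compl_singleton
  have hconn : IsPreconnected ({1}ᶜ : Set ℂ) :=
    (isConnected_compl_singleton_of_one_lt_rank (by simp) 1).isPreconnected
  have htop : analyticOrderAt riemannZeta ρ ≠ ⊤ := fun h =>
    riemannZeta_ne_zero_of_one_le_re (s := 2) (by norm_num) <|
      han.eqOn_zero_of_preconnected_of_eventuallyEq_zero hconn h1
        (analyticOrderAt_eq_top.1 h) (by norm_num)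
  have hne : analyticOrderAt riemannZeta ρ ≠ 0 := fun h =>
    ((han ρ h1).analyticOrderAt_eq_zero.1 h) h0
  rw [← Nat.cast_analyticOrderNatAt htop] at hne
  exact Nat.one_le_iff_ne_zero.2 (by exact_mod_cast hne)

theorem card_ordinates_le_zeroCount (T : ℝ) : (ordinates T).card ≤ zeroCount T := by
  refine (Finset.card_filter_le _ _).trans (Finset.card_image_le.trans ?_)
  rw [zeroCount, Finset.card_eq_sum_ones]
  refine Finset.sum_le_sum fun ρ hρ => ?_
  obtain ⟨h0, -, h2, -⟩ := (Set.Finite.mem_toFinset _).1 hρ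
  exact one_le_analyticOrderNatAt h0 (by rintro rfl; simp at h2)

theorem EffectiveLI.exists_nonresonant (h : EffectiveLI) {ε : ℝ} (hε : 0 < ε) :
    ∃ C : ℝ, 0 < C ∧ ∀ T : ℝ, 2 ≤ T →
      Nonresonant (C * Real.exp (-T ^ (1 + ε))) (ordinates T) := by
  obtain ⟨C, hC, hLI⟩ := h ε hε
  refine ⟨C, hC, fun T hT l hl hex => ?_⟩
  have hcard := card_ordinates_le_zeroCount T
  rcases le_or_gt 2 (zeroCount T) with h2 | h2
  · exact hLI T hT l hex fun γ _ => (hl γ).trans (by exact_mod_cast h2)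
  -- If `N(T) < 2`, a coefficient 2 is not admissible in Effective LI. There is then a single
  -- ordinate, and coefficient 1 suffices because `|l γ| ≥ 1`.
  · obtain ⟨γ, hγ, hlγ⟩ := hex
    have hpos : 0 < (ordinates T).card := Finset.card_pos.2 ⟨γ, hγ⟩
    obtain ⟨γ', hS⟩ := Finset.card_eq_one.1 (by omega : (ordinates T).card = 1)
    obtain rfl : γ = γ' := by simpa [hS] using hγ
    have key := hLI T hT (fun _ => 1) ⟨γ, hγ, one_ne_zero⟩ fun _ _ => by
      rw [abs_one]
      exact_mod_cast hpos.trans_le hcard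
    rw [hS, Finset.sum_singleton] at key ⊢
    refine key.trans ?_
    rw [abs_mul, abs_mul, Int.cast_one, abs_one, ← Int.cast_abs]
    exact mul_le_mul_of_nonneg_right (by exact_mod_cast Int.one_le_abs hlγ) (abs_nonneg _)

/-- The asymptotic bound covers only `T ≥ T₁`. Below `T₁` finitely many ordinates occur, so one
nonzero coefficient already contributes a fixed `μ > 0`, while `(log T)^A` stays bounded. -/
theorem CoeffGrowth.exists_le_coeffSum {r : ℝ → ℂ} {A : ℝ} (hA : 0 < A) (hr : CoeffGrowth r A) :
    ∃ c : ℝ, 0 < c ∧ ∀ T : ℝ, 2 ≤ T → (∃ γ ∈ ordinates T, r γ ≠ 0) →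
      c * Real.log T ^ A ≤ coeffSum r T := by
  obtain ⟨c', hc', hev⟩ := hr.2.exists_pos
  obtain ⟨T₁, hT₁⟩ := eventually_atTop.1 hev.bound
  obtain ⟨μ, hμ, hμr⟩ : ∃ μ : ℝ, 0 < μ ∧ ∀ γ ∈ ordinates T₁, r γ ≠ 0 → μ ≤ ‖r γ‖ := by
    rcases ((ordinates T₁).filter fun γ => r γ ≠ 0).eq_empty_or_nonempty with he | hne
    · exact ⟨1, one_pos, fun γ hγ h0 =>
        absurd h0 (Finset.filter_eq_empty_iff.1 he hγ)⟩
    · obtain ⟨γ₀, hγ₀, hmin⟩ := Finset.exists_min_image _ (fun γ => ‖r γ‖) hne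
      exact ⟨‖r γ₀‖, norm_pos_iff.2 (Finset.mem_filter.1 hγ₀).2,
        fun γ hγ h0 => hmin γ (Finset.mem_filter.2 ⟨hγ, h0⟩)⟩
  have hnonneg : ∀ T, 0 ≤ coeffSum r T := fun T => Finset.sum_nonneg fun _ _ => norm_nonneg _
  have hM0 : 0 < Real.log (max T₁ 2) := Real.log_pos (by
    linarith [le_max_right T₁ 2])
  have hM : 0 < Real.log (max T₁ 2) ^ A := Real.rpow_pos_of_pos hM0 _
  refine ⟨min c'⁻¹ (μ / Real.log (max T₁ 2) ^ A), by positivity, fun T hT hex => ?_⟩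
  have hlog : 0 < Real.log T := Real.log_pos (by linarith)
  have hpow : 0 ≤ Real.log T ^ A := by positivity
  rcases le_total T₁ T with h | h
  · have := hT₁ T h
    rw [Real.norm_of_nonneg hpow, Real.norm_of_nonneg (hnonneg T)] at this
    calc _ ≤ c'⁻¹ * Real.log T ^ A := mul_le_mul_of_nonneg_right (min_le_left _ _) hpow
      _ ≤ coeffSum r T := by rwa [inv_mul_le_iff₀ hc']
  · obtain ⟨γ, hγ, h0⟩ := hex
    obtain ⟨g1, g2, g3⟩ := (mem_ordinates T γ).1 hγ
    have hle : μ ≤ coeffSum r T :=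
      (hμr γ ((mem_ordinates T₁ γ).2 ⟨g1, g2.trans h, g3⟩) h0).trans
        (Finset.single_le_sum (f := fun γ => ‖r γ‖) (fun _ _ => norm_nonneg _) hγ)
    calc _ ≤ μ / Real.log (max T₁ 2) ^ A * Real.log T ^ A :=
          mul_le_mul_of_nonneg_right (min_le_right _ _) hpow
      _ ≤ μ / Real.log (max T₁ 2) ^ A * Real.log (max T₁ 2) ^ A := by
        gcongr
        exact h.trans (le_max_left _ _)
      _ = μ := div_mul_cancel₀ _ hM.ne'
      _ ≤ coeffSum r T := hle

/-! ### Absorbing the error term and conclusion -/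

theorem eventually_mul_exp_rpow_log_le (a b : ℝ) {δ : ℝ} (hδ : δ < 1) :
    ∀ᶠ X : ℝ in atTop, a * Real.exp (b * Real.log X ^ δ) ≤ X := by
  have h1 : ∀ᶠ L : ℝ in atTop, L ^ (-(1 - δ)) < 1 / (2 * (|b| + 1)) :=
    (tendsto_rpow_neg_atTop (by linarith)).eventually_lt_const (by positivity)
  have h2 : ∀ᶠ L : ℝ in atTop, a * Real.exp (b * L ^ δ) ≤ Real.exp L := by
    filter_upwards [h1, eventually_gt_atTop (0 : ℝ), eventually_ge_atTop (2 * |a|)]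
      with L hL hL0 hLa
    have hmul : L ^ (-(1 - δ)) * L = L ^ δ := by
      rw [← Real.rpow_add_one hL0.ne']; congr 1; ring
    rw [lt_div_iff₀ (by positivity)] at hL
    have hδL : L ^ δ * (2 * (|b| + 1)) ≤ L := by
      rw [← hmul, mul_right_comm]
      exact mul_le_of_le_one_left hL0.le hL.le
    have h3 : b * L ^ δ ≤ L / 2 := by
      have : b * L ^ δ ≤ (|b| + 1) * L ^ δ :=
        mul_le_mul_of_nonneg_right (by linarith [le_abs_self b]) (by positivity)
      linarith
    have h4 : a ≤ Real.exp (L / 2) := by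
      linarith [Real.add_one_le_exp (L / 2), le_abs_self a]
    calc a * Real.exp (b * L ^ δ) ≤ Real.exp (L / 2) * Real.exp (L / 2) :=
          mul_le_mul h4 (Real.exp_le_exp.2 h3) (Real.exp_pos _).le (Real.exp_pos _).le
      _ = Real.exp L := by rw [← Real.exp_add, add_halves]
  filter_upwards [Real.tendsto_log_atTop.eventually h2, eventually_gt_atTop 0] with X hX hX0
  rwa [Real.exp_log hX0] at hX

theorem two_pow_card_ordinates_le {c T : ℝ} (h : ((ordinates T).card : ℝ) ≤ c * (T * Real.log T)) :
    (2 : ℝ) ^ (ordinates T).card ≤ Real.exp (c * (T * Real.log T)) := by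
  refine le_trans ?_ (Real.exp_le_exp.2 h)
  rw [← Real.exp_one_pow]
  exact pow_le_pow_left₀ (by norm_num) (by linarith [Real.add_one_le_exp (1 : ℝ)]) _

/-- Lower bound for the frequency of large values, with arbitrary phases. -/
theorem EffectiveLI.exists_le_measureReal (hELI : EffectiveLI) {ε : ℝ} (hε : 0 < ε) :
    ∃ c : ℝ, 0 < c ∧ ∀ᶠ X : ℝ in atTop, ∀ T : ℝ, 2 ≤ T → T ≤ Real.log X ^ (1 - ε) →
      ∀ θ w : ℝ → ℝ, (∀ γ ∈ ordinates T, 0 ≤ w γ) → 0 < ∑ γ ∈ ordinates T, w γ →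
        1 / 8 * Real.exp (-c * T * Real.log T) ≤ 1 / X * volume.real {t : ℝ | t ∈ Set.Icc 1 X ∧
          (∑ γ ∈ ordinates T, w γ) / 4 < ∑ γ ∈ ordinates T, w γ * Real.cos (γ * t + θ γ)} := by
  obtain ⟨c, hc, hcard⟩ := exists_card_ordinates_le
  obtain ⟨C, hC, hres⟩ := hELI.exists_nonresonant hε
  refine ⟨c, hc, ?_⟩
  -- The exponent `(1 - ε)(1 + ε)` is below 1, and `c / ε + 1` comes from `log T ≤ T^ε / ε`. The
  -- error is then at most `X / 16`; with `1/4 ≤ X / 16` from `X ≥ 4`, at least `X / 8` of the main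
  -- term `X / 4` survives.
  filter_upwards [eventually_mul_exp_rpow_log_le (16 * (5 / 4 * (2 / C))) (c / ε + 1)
    (δ := (1 - ε) * (1 + ε)) (by nlinarith), eventually_ge_atTop 4] with X hXe hX4
  intro T hT hTX θ w hw hpos
  have hlogX : 0 < Real.log X := Real.log_pos (by linarith)
  have hT0 : 0 < T := by linarith
  have hY : T ^ (1 + ε) ≤ Real.log X ^ ((1 - ε) * (1 + ε)) := by
    rw [Real.rpow_mul hlogX.le]
    exact Real.rpow_le_rpow hT0.le hTX (by linarith)
  have hTlog : T * Real.log T ≤ T ^ (1 + ε) / ε := by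
    rw [Real.rpow_add hT0, Real.rpow_one, mul_div_assoc]
    exact mul_le_mul_of_nonneg_left (Real.log_le_rpow_div hT0.le hε) hT0.le
  have h2K := two_pow_card_ordinates_le (hcard T hT)
  have hm : 0 < C * Real.exp (-T ^ (1 + ε)) := by positivity
  have key := le_measureReal_quarter_lt_sum_cos θ w hm (by linarith : 1 ≤ X) (hres T hT) hw hpos
  set V := volume.real {t : ℝ | t ∈ Set.Icc 1 X ∧
    (∑ γ ∈ ordinates T, w γ) / 4 < ∑ γ ∈ ordinates T, w γ * Real.cos (γ * t + θ γ)} with hV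
  have herr : (2 : ℝ) ^ (ordinates T).card * (2 / (C * Real.exp (-T ^ (1 + ε)))) ≤
      2 / C * Real.exp ((c / ε + 1) * Real.log X ^ ((1 - ε) * (1 + ε))) := by
    have e : 2 / (C * Real.exp (-T ^ (1 + ε))) = 2 / C * Real.exp (T ^ (1 + ε)) := by
      rw [Real.exp_neg, div_mul_eq_div_div, div_inv_eq_mul]
    rw [e, mul_left_comm]
    refine mul_le_mul_of_nonneg_left ?_ (by positivity)
    refine (mul_le_mul_of_nonneg_right h2K (Real.exp_pos _).le).trans ?_
    rw [← Real.exp_add]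
    refine Real.exp_le_exp.2 ?_
    calc c * (T * Real.log T) + T ^ (1 + ε) ≤ c * (T ^ (1 + ε) / ε) + T ^ (1 + ε) := by gcongr
      _ = (c / ε + 1) * T ^ (1 + ε) := by ring
      _ ≤ _ := by gcongr
  have hmain : X / 8 ≤ 2 ^ (ordinates T).card * V := by linarith
  have hfin : X / 8 ≤ Real.exp (c * (T * Real.log T)) * V :=
    hmain.trans (mul_le_mul_of_nonneg_right h2K measureReal_nonneg)
  rw [show -c * T * Real.log T = -(c * (T * Real.log T)) by ring, Real.exp_neg, one_div_mul_eq_div,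
    one_div_mul_eq_div, le_div_iff₀ (by linarith), div_mul_eq_mul_div, div_le_iff₀ (by norm_num),
    inv_mul_le_iff₀ (Real.exp_pos _)]
  linarith

end ZetaSums

theorem mainTheorem4 (hELI : ZetaSums.EffectiveLI)
    (r : ℝ → ℂ) (A : ℝ) (hA : 0 < A) (hr : ZetaSums.CoeffGrowth r A)
    (ε : ℝ) (hε : 0 < ε) :
    ∃ c₁ c₂ C : ℝ, 0 < c₁ ∧ 0 < c₂ ∧ 0 < C ∧ ∀ᶠ X : ℝ in atTop,
      ∀ T : ℝ, 2 ≤ T → T ≤ Real.log X ^ (1 - ε) →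
        (∃ γ ∈ ZetaSums.ordinates T, r γ ≠ 0) →
        C * Real.exp (-c₂ * T * Real.log T) ≤
            1 / X * volume.real {t : ℝ | t ∈ Set.Icc 1 X ∧
              ZetaSums.shortSum r t T > c₁ * Real.log T ^ A} ∧
        C * Real.exp (-c₂ * T * Real.log T) ≤
            1 / X * volume.real {t : ℝ | t ∈ Set.Icc 1 X ∧
              ZetaSums.shortSum r t T < -c₁ * Real.log T ^ A} := by
  obtain ⟨c, hc, hcH⟩ := hr.exists_le_coeffSum hA
  obtain ⟨c₂, hc₂, hmeas⟩ := hELI.exists_le_measureReal hε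
  refine ⟨c / 4, c₂, 1 / 8, by positivity, hc₂, by norm_num, ?_⟩
  filter_upwards [hmeas, eventually_gt_atTop 0] with X hX hX0
  intro T hT hTX hex
  have hH := hcH T hT hex
  have hpos : 0 < ∑ γ ∈ ZetaSums.ordinates T, ‖r γ‖ := by
    obtain ⟨γ, hγ, h0⟩ := hex
    exact Finset.sum_pos' (fun _ _ => norm_nonneg _) ⟨γ, hγ, norm_pos_iff.2 h0⟩
  rw [ZetaSums.coeffSum] at hH
  have hmono {D D' : Set ℝ} (h : D ⊆ D') (hD' : D' ⊆ Set.Icc 1 X) :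
      1 / X * volume.real D ≤ 1 / X * volume.real D' :=
    mul_le_mul_of_nonneg_left (measureReal_mono h
      ((measure_mono hD').trans_lt measure_Icc_lt_top).ne) (by positivity)
  constructor
  · refine (hX T hT hTX (fun γ => Complex.arg (r γ)) (fun γ => ‖r γ‖) (fun _ _ => norm_nonneg _)
      hpos).trans (hmono (fun t ht => ⟨ht.1, ?_⟩) fun t ht => ht.1)
    have e : ZetaSums.shortSum r t T =
        ∑ γ ∈ ZetaSums.ordinates T, ‖r γ‖ * Real.cos (γ * t + Complex.arg (r γ)) :=
      Finset.sum_congr rfl fun γ _ => mul_comm _ _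
    rw [e]
    linarith [ht.2]
  -- Shifting every phase by `π` changes the sign of `F`.
  · refine (hX T hT hTX (fun γ => Complex.arg (r γ) + Real.pi) (fun γ => ‖r γ‖)
      (fun _ _ => norm_nonneg _) hpos).trans (hmono (fun t ht => ⟨ht.1, ?_⟩) fun t ht => ht.1)
    have e : -ZetaSums.shortSum r t T =
        ∑ γ ∈ ZetaSums.ordinates T, ‖r γ‖ * Real.cos (γ * t + (Complex.arg (r γ) + Real.pi)) := by
      rw [ZetaSums.shortSum, ← Finset.sum_neg_distrib]
      refine Finset.sum_congr rfl fun γ _ => ?_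
      rw [← add_assoc, Real.cos_add_pi]
      ring
    have h2 := ht.2
    rw [← e] at h2
    linarith
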